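/- **Hirota form of the elliptic $\tau$-function.** Let $\Lambda\subset\mathbb C$ be a period lattice of rank two, with Weierstrass functions $$\sigma(z)=z\prod_{0\ne\omega\in\Lambda}\Big(1-\frac z\omega\Big)e^{z/\omega+z^2/(2\omega^2)},\qquad \zeta(z)=\frac1z+\sum_{0\ne\omega\in\Lambda}\Big(\frac1{z-\omega}+\frac1\omega+\frac z{\omega^2}\Big),$$ and put $\Psi_\xi(\kappa)=\dfrac{\sigma(\kappa+\xi)}{\sigma(\xi)\sigma(\kappa)}\,e^{-\zeta(\xi)\kappa}$. Let $N,N'\ge 0$, let $\kappa_1,\dots,\kappa_N,\kappa_1',\dots,\kappa_{N'}'\in\mathbb C$ satisfy $\kappa_i+\kappa_j'\notin\Lambda$ for all $i,j$, let $C$ be a constant complex $N'\times N$ matrix, let $\xi_0,\delta,\varepsilon,\lambda\in\mathbb C$ and let $\rho_{0,0,0}:\mathbb C\to\mathbb C$ be arbitrary. For $(n,m,h)\in\mathbb Z^3$ put $\xi=\xi_0+n\delta+m\varepsilon+h\lambda$ and $$\rho(\kappa)=\big(e^{-\zeta(\delta)\kappa}\Psi_\delta(-\kappa)\big)^{n}\big(e^{-\zeta(\varepsilon)\kappa}\Psi_\varepsilon(-\kappa)\big)^{m}\big(e^{-\zeta(\lambda)\kappa}\Psi_\lambda(-\kappa)\big)^{h}e^{\zeta(\xi)\kappa}\rho_{0,0,0}(\kappa),$$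 $$\nu(\kappa)=\big(e^{\zeta(\delta)\kappa}\Psi_\delta(\kappa)\big)^{-n}\big(e^{\zeta(\varepsilon)\kappa}\Psi_\varepsilon(\kappa)\big)^{-m}\big(e^{\zeta(\lambda)\kappa}\Psi_\lambda(\kappa)\big)^{-h}e^{\zeta(\xi)\kappa}\rho_{0,0,0}(\kappa),$$ for parameters for which these are defined. Let $\rho_i=\rho(\kappa_i)$, $\nu_j=\nu(\kappa_j')$, let $M$ be the $N\times N'$ matrix $M_{ij}=\rho_i\Psi_\xi(\kappa_i+\kappa_j')\nu_j$, and let $\tau=\tau_{n,m,h}=\det(1+MC)$. Write $$e^{\theta_i}:=\rho_ie^{-\zeta(\xi)\kappa_i},\quad e^{\eta_l}:=\nu_le^{-\zeta(\xi)\kappa_l'},\quad e^{A_{i,j}}:=\sigma(\kappa_i-\kappa_j),\quad e^{E_{k,l}}:=\sigma(\kappa_k'-\kappa_l').$$ These symbols stand for the values on the right, which may vanish; where none of the values concerned vanishes one may equivalently take any exponents $\theta_i,\eta_l$, and $A_{i,j}$, $E_{k,l}$ for $i<j$, $k<l$, with these exponentials. Then at every $(n,m,h)$ with $\xi\notin\Lambda$,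 $$\tau=1+\sum_{r=1}^{\min(N,N')}\ \sum_{1\le i_1<\dots<i_r\le N} e^{\sum_a\theta_{i_a}+\sum_{a<b}A_{i_a,i_b}}\sum_{1\le l_1<\dots<l_r\le N'} e^{\sum_f\eta_{l_f}+\sum_{f<g}E_{l_f,l_g}}\ \det\big(C_{l_f,i_a}\big)_{f,a=1}^{r}\ \frac{\sigma\big(\xi+\sum_a\kappa_{i_a}+\sum_f\kappa'_{l_f}\big)}{\sigma(\xi)\prod_{a,f=1}^{r}\sigma(\kappa_{i_a}+\kappa'_{l_f})}.$$ In particular the discrete variables $n,m,h$ enter $\tau$ only through $\xi$, the $\theta_i$ and the $\eta_l$: there is a function $F$ determined by $\Lambda$, the $\kappa_i$, the $\kappa'_j$ and $C$ alone, independent of $\xi_0,\delta,\varepsilon,\lambda,\rho_{0,0,0}$ and of $n,m,h$, such that $\tau_{n,m,h}=F\big(\xi,(e^{\theta_i})_i,(e^{\eta_l})_l\big)$ whenever $\xi\notin\Lambda$. -/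

import Mathlib

noncomputable section

/-- The Weierstrass sigma function of the period lattice `Λ` of `L`:
`σ(z) = z ∏_{ω ∈ Λ, ω ≠ 0} (1 - z/ω) exp (z/ω + z²/(2ω²))`. -/
def weierstrassSigma (L : PeriodPair) (z : ℂ) : ℂ :=
  z * ∏' ω : L.lattice,
    if (ω : ℂ) = 0 then 1
    else (1 - z / ω) * Complex.exp (z / ω + z ^ 2 / (2 * (ω : ℂ) ^ 2))

/-- The Weierstrass zeta function of the period lattice `Λ` of `L`:
`ζ(z) = 1/z + ∑_{ω ∈ Λ, ω ≠ 0} (1/(z - ω) + 1/ω + z/ω²)`. -/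
def weierstrassZeta (L : PeriodPair) (z : ℂ) : ℂ :=
  1 / z + ∑' ω : L.lattice,
    if (ω : ℂ) = 0 then 0
    else 1 / (z - ω) + 1 / ω + z / (ω : ℂ) ^ 2

/-- `Φ_ξ(κ) = σ(κ + ξ) / (σ(ξ) σ(κ))`. -/
def lamePhi (L : PeriodPair) (ξ κ : ℂ) : ℂ :=
  weierstrassSigma L (κ + ξ) / (weierstrassSigma L ξ * weierstrassSigma L κ)

/-- The Lamé function `Ψ_ξ(κ) = Φ_ξ(κ) exp (-ζ(ξ) κ)`. -/
def lamePsi (L : PeriodPair) (ξ κ : ℂ) : ℂ :=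
  lamePhi L ξ κ * Complex.exp (-weierstrassZeta L ξ * κ)

/-- The free parameters of an elliptic `(N, N')`-soliton solution. -/
structure EllipticSolitonData (N N' : ℕ) where
  /-- the periods of the sigma function -/
  L : PeriodPair
  /-- the rapidities `κ₁, …, κ_N` -/
  κ : Fin N → ℂ
  /-- the rapidities `κ'₁, …, κ'_{N'}` -/
  κ' : Fin N' → ℂ
  /-- the constant coefficient matrix -/
  C : Matrix (Fin N') (Fin N) ℂ
  /-- the value of `ξ` at `(n, m, h) = (0, 0, 0)` -/
  ξ₀ : ℂ
  /-- the lattice parameter of the variable `n` -/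
  δ : ℂ
  /-- the lattice parameter of the variable `m` -/
  ε : ℂ
  /-- the lattice parameter of the variable `h` -/
  lam : ℂ
  /-- the constant prefactor `κ ↦ ρ_{0,0,0}(κ)` of the plane-wave factors -/
  ρ₀ : ℂ → ℂ

namespace EllipticSolitonData

variable {N N' : ℕ} (D : EllipticSolitonData N N')

/-- The sigma function of the data. -/
def sigma (z : ℂ) : ℂ := weierstrassSigma D.L z

/-- The zeta function of the data. -/
def zeta (z : ℂ) : ℂ := weierstrassZeta D.L z

/-- `ξ = ξ₀ + n δ + m ε + h λ`. -/
def xi (n m h : ℤ) : ℂ := D.ξ₀ + n * D.δ + m * D.ε + h * D.lam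

/-- `p_κ = Ψ_δ(κ)`. -/
def p (k : ℂ) : ℂ := lamePsi D.L D.δ k

/-- `q_κ = Ψ_ε(κ)`. -/
def q (k : ℂ) : ℂ := lamePsi D.L D.ε k

/-- `l_κ = Ψ_λ(κ)`. -/
def l (k : ℂ) : ℂ := lamePsi D.L D.lam k

/-- The plane-wave factor `ρ(κ)` at the lattice point `(n, m, h)`. -/
def rho (n m h : ℤ) (k : ℂ) : ℂ :=
  (Complex.exp (-D.zeta D.δ * k) * D.p (-k)) ^ n *
  (Complex.exp (-D.zeta D.ε * k) * D.q (-k)) ^ m *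
  (Complex.exp (-D.zeta D.lam * k) * D.l (-k)) ^ h *
  Complex.exp (D.zeta (D.xi n m h) * k) * D.ρ₀ k

/-- The plane-wave factor `ν(κ')` at the lattice point `(n, m, h)`. -/
def nu (n m h : ℤ) (k : ℂ) : ℂ :=
  (Complex.exp (D.zeta D.δ * k) * D.p k) ^ (-n) *
  (Complex.exp (D.zeta D.ε * k) * D.q k) ^ (-m) *
  (Complex.exp (D.zeta D.lam * k) * D.l k) ^ (-h) *
  Complex.exp (D.zeta (D.xi n m h) * k) * D.ρ₀ k

/-- The bare elliptic Cauchy matrix `M⁰_{i,j} = Ψ_ξ(κ_i + κ'_j)`. -/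
def bareCauchy (n m h : ℤ) : Matrix (Fin N) (Fin N') ℂ :=
  Matrix.of fun i j => lamePsi D.L (D.xi n m h) (D.κ i + D.κ' j)

/-- The dressed elliptic Cauchy matrix `M_{i,j} = ρ_i M⁰_{i,j} ν_j`. -/
def cauchy (n m h : ℤ) : Matrix (Fin N) (Fin N') ℂ :=
  Matrix.of fun i j =>
    D.rho n m h (D.κ i) * D.bareCauchy n m h i j * D.nu n m h (D.κ' j)

/-- The τ-function `τ_{n,m,h} = det (1 + M C)`. -/
def tau (n m h : ℤ) : ℂ := (1 + D.cauchy n m h * D.C).det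

/-- The quantity denoted `e^{θ_i}`, namely `ρ_i exp (-ζ(ξ) κ_i)`. -/
def expTheta (n m h : ℤ) (i : Fin N) : ℂ :=
  D.rho n m h (D.κ i) * Complex.exp (-D.zeta (D.xi n m h) * D.κ i)

/-- The quantity denoted `e^{η_j}`, namely `ν_j exp (-ζ(ξ) κ'_j)`. -/
def expEta (n m h : ℤ) (j : Fin N') : ℂ :=
  D.nu n m h (D.κ' j) * Complex.exp (-D.zeta (D.xi n m h) * D.κ' j)

/-- The quantity denoted `e^{A_{i,j}}`, namely `σ(κ_i - κ_j)`. -/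
def expA (i j : Fin N) : ℂ := D.sigma (D.κ i - D.κ j)

/-- The quantity denoted `e^{E_{i,j}}`, namely `σ(κ'_i - κ'_j)`. -/
def expE (i j : Fin N') : ℂ := D.sigma (D.κ' i - D.κ' j)

/-- The ratio of sigma functions attached to rows `i₁ < ⋯ < i_r` and columns `j₁ < ⋯ < j_r`
of the Cauchy matrix, at a given value `x` of `ξ`:
`σ(x + ∑ₐ κ_{iₐ} + ∑_f κ'_{j_f}) / (σ(x) ∏_{a,f} σ(κ_{iₐ} + κ'_{j_f}))`. -/
def sigmaRatio (x : ℂ) {r : ℕ} (i : Fin r ↪o Fin N) (j : Fin r ↪o Fin N') : ℂ :=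
  D.sigma (x + ∑ a, D.κ (i a) + ∑ f, D.κ' (j f)) /
    (D.sigma x * ∏ a, ∏ f, D.sigma (D.κ (i a) + D.κ' (j f)))

end EllipticSolitonData

end

/-!
The matrix entry `ρ_i Ψ_ξ(κ_i + κ'_j) ν_j` equals `e^{θ_i} Φ_ξ(κ_i + κ'_j) e^{η_j}`, because the
exponential in `Ψ_ξ` splits as a product of a factor in `κ_i` and a factor in `κ'_j`. Hence every
minor of `M` is a product of plane-wave factors and an elliptic Cauchy determinant, and the theorem
results from two facts.

* `det (1 + M C)` is the sum of the principal minors of `M C`, and the Cauchy–Binet formula expands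
  each of these over pairs of minors of `M` and `C` (`det_one_add_mul_eq_sum_minors`). Pairs of size
  `r > N'` do not exist, which gives the range `r ≤ min N N'`.
* The Frobenius formula (`det_lamePhi`) evaluates `det (Φ_ξ(x_i + y_j))` as a product of sigma
  functions.

The Frobenius formula is proved by Gaussian elimination: after one pivot step the remaining matrix
is, up to row and column factors, of the same form with `ξ + x₀ + y₀` in place of `ξ`. This is the
case of order two, the three-term identity `weierstrassSigma_three_term`. Vanishing pivots are
removed by continuity in `ξ`.

The three-term identity is an instance of Liouville's theorem. In the variable `ξ` its two sides
have the same multipliers under periods, and the left side vanishes at the simple zeros of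
`σ(ξ) σ(ξ + s)`, `s = x₁ + x₂ + y₁ + y₂`; the quotient is entire and doubly periodic, hence
constant. The quasi-periodicity of `σ` (`exists_weierstrassSigma_add`) follows from
`(log σ)'' = -℘` and the periodicity of `℘`. The equation `(log σ)'' = -℘` is obtained from the
locally uniform convergence of the sigma product, whose partial products have second logarithmic
derivatives equal to partial sums of `-℘`, and the summation of the zeta series is not needed.
-/

/-! ### Determinants: principal minors and the Cauchy–Binet formula -/

section Determinants

variable {R : Type*} [CommRing R]

/-- Subsets of `Fin n` of size `r` are the images of the increasing maps `Fin r → Fin n`. -/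
theorem sum_powersetCard_eq_sum_orderEmbedding {M : Type*} [AddCommMonoid M] (n r : ℕ)
    (g : Finset (Fin n) → M) :
    ∑ s ∈ Finset.univ.powersetCard r, g s =
      ∑ e : Fin r ↪o Fin n, g (Finset.univ.map e.toEmbedding) := by
  symm
  refine Finset.sum_bij (fun e _ ↦ Finset.univ.map e.toEmbedding) ?_ ?_ ?_ ?_
  · intro e _
    simp [Finset.mem_powersetCard]
  · intro e _ e' _ h
    have h' : Set.range e = Set.range e' := by
      have := congrArg (fun s : Finset (Fin n) ↦ (s : Set (Fin n))) h
      simpa using this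
    exact OrderEmbedding.range_inj.mp h'
  · intro s hs
    refine ⟨s.orderEmbOfFin (Finset.mem_powersetCard.mp hs).2, Finset.mem_univ _, ?_⟩
    ext x
    simp
  · intro e _
    rfl

theorem det_one_add_eq_sum_principal_minors {n : ℕ} (A : Matrix (Fin n) (Fin n) R) :
    (1 + A).det =
      ∑ r ∈ Finset.range (n + 1), ∑ e : Fin r ↪o Fin n, (A.submatrix e e).det := by
  have h1 : (1 + A).det =
      ((1 + (Polynomial.X : Polynomial R) • A.map Polynomial.C).det).eval 1 := by
    rw [← Polynomial.coe_evalRingHom, RingHom.map_det]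
    congr 1
    ext i j
    by_cases hij : i = j <;> simp [hij]
  have hdeg : ((1 + (Polynomial.X : Polynomial R) • A.map Polynomial.C).det).natDegree < n + 1 := by
    have := Polynomial.natDegree_det_X_add_C_le A (1 : Matrix (Fin n) (Fin n) R)
    rw [add_comm]
    simpa [Nat.lt_succ_iff] using this
  rw [h1, Polynomial.eval_eq_sum_range' hdeg]
  refine Finset.sum_congr rfl fun r _ ↦ ?_
  rw [one_pow, mul_one, Matrix.coeff_det_one_add_X_smul_eq_sum_minors,
    sum_powersetCard_eq_sum_orderEmbedding n r
      (fun s ↦ (A.submatrix (Subtype.val : s → Fin n) Subtype.val).det)]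
  refine Finset.sum_congr rfl fun e _ ↦ ?_
  let E : Fin r ≃ (Finset.univ.map e.toEmbedding : Finset (Fin n)) :=
    Equiv.ofBijective (fun a ↦ ⟨e a, by simp⟩)
      ⟨fun a b h ↦ e.injective (by simpa using h), fun ⟨x, hx⟩ ↦ by
        obtain ⟨a, -, ha⟩ := Finset.mem_map.mp hx
        exact ⟨a, Subtype.ext ha⟩⟩
  rw [← Matrix.det_submatrix_equiv_self E]
  rfl

/-- Every injective map `Fin r → Fin n` is uniquely an increasing map precomposed with a
permutation. -/
theorem sum_injective_eq_sum_orderEmbedding_perm {M : Type*} [AddCommMonoid M] (n r : ℕ)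
    (g : (Fin r → Fin n) → M) :
    ∑ f : Fin r → Fin n with Function.Injective f, g f =
      ∑ e : Fin r ↪o Fin n, ∑ π : Equiv.Perm (Fin r), g (e ∘ π) := by
  rw [← Fintype.sum_prod_type']
  symm
  refine Finset.sum_bij (fun p _ ↦ p.1 ∘ p.2) ?_ ?_ ?_ ?_
  · rintro ⟨e, π⟩ _
    simpa using! e.injective
  · rintro ⟨e, π⟩ _ ⟨e', π'⟩ _ h
    dsimp only at h
    have hr : Set.range e = Set.range e' := by
      have := congrArg Set.range h
      simpa [Set.range_comp] using this
    have he : e = e' := OrderEmbedding.range_inj.mp hr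
    subst he
    have hπ : π = π' := Equiv.ext fun a ↦ e.injective (congrFun h a)
    rw [hπ]
  · intro f hf
    have hf' : Function.Injective f := by simpa using hf
    refine ⟨(OrderEmbedding.ofStrictMono (f ∘ Tuple.sort f)
      ((Tuple.monotone_sort f).strictMono_of_injective
        (hf'.comp (Tuple.sort f).injective)), (Tuple.sort f)⁻¹), Finset.mem_univ _, ?_⟩
    ext a
    simp
  · rintro ⟨e, π⟩ _
    rfl

/-- The **Cauchy–Binet formula**. -/
theorem det_mul_eq_sum_minors {n r : ℕ} (A : Matrix (Fin r) (Fin n) R)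
    (B : Matrix (Fin n) (Fin r) R) :
    (A * B).det = ∑ e : Fin r ↪o Fin n, (A.submatrix id e).det * (B.submatrix e id).det := by
  have h1 : (A * B).det = ∑ f : Fin r → Fin n, (∏ i, A i (f i)) * (B.submatrix f id).det := by
    have := (Matrix.detRowAlternating (n := Fin r) (R := R)).toMultilinearMap.map_sum
      (g := fun i k ↦ A i k • B k)
    have h2 : A * B = fun i ↦ ∑ k, A i k • B k := by
      ext i j
      simp [Matrix.mul_apply, Finset.sum_apply]
    rw [h2]
    refine this.trans (Finset.sum_congr rfl fun f _ ↦ ?_)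
    exact (Matrix.detRowAlternating (n := Fin r) (R := R)).toMultilinearMap.map_smul_univ _ _
  -- Non-injective maps select a repeated row of `B`.
  have h2 : ∑ f : Fin r → Fin n, (∏ i, A i (f i)) * (B.submatrix f id).det =
      ∑ f : Fin r → Fin n with Function.Injective f,
        (∏ i, A i (f i)) * (B.submatrix f id).det := by
    symm
    refine Finset.sum_subset (Finset.filter_subset _ _) fun f _ hf ↦ ?_
    have hf' : ¬ Function.Injective f := by simpa using hf
    obtain ⟨a, b, hab, hne⟩ := Function.not_injective_iff.mp hf'
    rw [Matrix.det_zero_of_row_eq hne, mul_zero]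
    ext j
    simp [hab]
  rw [h1, h2, sum_injective_eq_sum_orderEmbedding_perm]
  refine Finset.sum_congr rfl fun e _ ↦ ?_
  have h3 : ∀ π : Equiv.Perm (Fin r), (B.submatrix (e ∘ π) id).det =
      (Equiv.Perm.sign π : R) * (B.submatrix e id).det := fun π ↦ by
    rw [← Matrix.det_permute π (B.submatrix e id)]
    rfl
  rw [← Matrix.det_transpose, Matrix.det_apply', Finset.sum_mul]
  refine Finset.sum_congr rfl fun π _ ↦ ?_
  rw [h3]
  simp only [Function.comp_apply, Matrix.transpose_apply, Matrix.submatrix_apply, id]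
  ring

/-- Expansion of `det (1 + M C)` over pairs of minors of `M` and `C`. -/
theorem det_one_add_mul_eq_sum_minors {n n' : ℕ} (M : Matrix (Fin n) (Fin n') R)
    (C : Matrix (Fin n') (Fin n) R) :
    (1 + M * C).det = 1 + ∑ r ∈ Finset.Icc 1 (min n n'), ∑ i : Fin r ↪o Fin n,
      ∑ j : Fin r ↪o Fin n', (M.submatrix i j).det * (C.submatrix j i).det := by
  have hminor : ∀ (r : ℕ) (i : Fin r ↪o Fin n), ((M * C).submatrix i i).det =
      ∑ j : Fin r ↪o Fin n', (M.submatrix i j).det * (C.submatrix j i).det := fun r i ↦ by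
    rw [← Matrix.submatrix_mul_equiv M C i (Equiv.refl _) i, det_mul_eq_sum_minors]
    rfl
  rw [det_one_add_eq_sum_principal_minors]
  simp_rw [hminor]
  rw [Finset.sum_range_succ', add_comm]
  congr 1
  · have (m : ℕ) : Subsingleton (Fin 0 ↪o Fin m) :=
      ⟨fun e e' ↦ RelEmbedding.ext fun a ↦ a.elim0⟩
    rw [Fintype.sum_subsingleton _ (OrderEmbedding.ofIsEmpty : Fin 0 ↪o Fin n),
      Fintype.sum_subsingleton _ (OrderEmbedding.ofIsEmpty : Fin 0 ↪o Fin n')]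
    simp
  · rw [Finset.range_eq_Ico, Finset.sum_Ico_add' (fun r ↦ ∑ i : Fin r ↪o Fin n,
      ∑ j : Fin r ↪o Fin n', (M.submatrix i j).det * (C.submatrix j i).det) 0 n 1]
    symm
    refine Finset.sum_subset (fun r hr ↦ ?_) fun r hr hr' ↦ ?_
    · simp only [Finset.mem_Icc, Finset.mem_Ico] at hr ⊢
      omega
    -- For `r > n'` there is no increasing map `Fin r → Fin n'`.
    · have hlt : n' < r := by
        simp only [Finset.mem_Icc, Finset.mem_Ico] at hr hr'
        omega
      have : IsEmpty (Fin r ↪o Fin n') := ⟨fun e ↦ by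
        have := Fintype.card_le_of_embedding e.toEmbedding
        simp at this
        omega⟩
      simp

/-- One step of Gaussian elimination with pivot the upper left entry. -/
theorem det_succ_eq_pivot_mul_det {K : Type*} [Field K] {n : ℕ}
    (A : Matrix (Fin (n + 1)) (Fin (n + 1)) K) (h : A 0 0 ≠ 0) :
    A.det = A 0 0 * (Matrix.of fun i j : Fin n ↦
      A i.succ j.succ - A i.succ 0 / A 0 0 * A 0 j.succ).det := by
  let B : Matrix (Fin (n + 1)) (Fin (n + 1)) K :=
    Matrix.of fun i j ↦ A i j - (if i = 0 then 0 else A i 0 / A 0 0) * A 0 j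
  have hB : A.det = B.det := by
    refine Matrix.det_eq_of_forall_row_eq_smul_add_const
      (fun i ↦ if i = 0 then 0 else A i 0 / A 0 0) 0 (by simp) fun i j ↦ ?_
    simp [B]
  rw [hB, Matrix.det_succ_column_zero, Fin.sum_univ_succ]
  have hz : ∀ i : Fin n, B i.succ 0 = 0 := fun i ↦ by
    simp [B, h]
  simp only [hz]
  simp only [Fin.val_zero, pow_zero, one_mul, mul_zero, zero_mul, Finset.sum_const_zero, add_zero]
  congr 1
  · simp [B]

end Determinants

/-! ### The sigma function: convergence, zeros and quasi-periodicity -/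

section Sigma

open Filter Topology

/-- The Weierstrass primary factor `(1 - w) exp (w + w²/2)` is `1 + O(w³)`, because its
derivative is `-w² exp (w + w²/2)`. -/
theorem norm_primaryFactor_two_sub_one_le {w : ℂ} (hw : ‖w‖ ≤ 1) :
    ‖(1 - w) * Complex.exp (w + w ^ 2 / 2) - 1‖ ≤ Real.exp 2 * ‖w‖ ^ 3 := by
  have hd : ∀ x : ℂ, HasDerivAt (fun w : ℂ ↦ (1 - w) * Complex.exp (w + w ^ 2 / 2))
      (-x ^ 2 * Complex.exp (x + x ^ 2 / 2)) x := fun x ↦ by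
    have h1 : HasDerivAt (fun w : ℂ ↦ w + w ^ 2 / 2) (1 + x) x := by
      have := (hasDerivAt_id x).add (((hasDerivAt_id x).pow 2).div_const 2)
      refine this.congr_deriv ?_
      simp
    have h2 := ((hasDerivAt_id x).const_sub 1).mul h1.cexp
    refine h2.congr_deriv ?_
    simp only [id]
    ring
  have hb : ∀ x ∈ Metric.closedBall (0 : ℂ) ‖w‖,
      ‖deriv (fun w : ℂ ↦ (1 - w) * Complex.exp (w + w ^ 2 / 2)) x‖ ≤ ‖w‖ ^ 2 * Real.exp 2 := by
    intro x hx
    have hx' : ‖x‖ ≤ ‖w‖ := by simpa using hx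
    have hx1 : ‖x‖ ≤ 1 := hx'.trans hw
    rw [(hd x).deriv, norm_mul, norm_neg, norm_pow]
    gcongr
    refine (Complex.norm_exp_le_exp_norm _).trans (Real.exp_le_exp.mpr ?_)
    calc ‖x + x ^ 2 / 2‖ ≤ ‖x‖ + ‖x‖ ^ 2 / 2 := by
          refine (norm_add_le _ _).trans ?_
          simp
      _ ≤ 2 := by nlinarith [norm_nonneg x]
  have := (convex_closedBall (0 : ℂ) ‖w‖).norm_image_sub_le_of_norm_deriv_le
    (fun x _ ↦ (hd x).differentiableAt) hb (x := 0) (y := w) (by simp) (by simp)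
  simp only [sub_zero, one_mul, zero_pow two_ne_zero, zero_div, add_zero, Complex.exp_zero] at this
  exact this.trans (le_of_eq (by ring))

variable (L : PeriodPair)

/-- The factor of the sigma product attached to a period `ω`; it is `1` for `ω = 0`. -/
noncomputable def sigmaFactor (ω : L.lattice) (z : ℂ) : ℂ :=
  if (ω : ℂ) = 0 then 1
  else (1 - z / ω) * Complex.exp (z / ω + z ^ 2 / (2 * (ω : ℂ) ^ 2))

/-- The product `σ(z) / z` over the nonzero periods. -/
noncomputable def sigmaProd (z : ℂ) : ℂ := ∏' ω : L.lattice, sigmaFactor L ω z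

theorem weierstrassSigma_eq (z : ℂ) : weierstrassSigma L z = z * sigmaProd L z := rfl

theorem differentiable_sigmaFactor (ω : L.lattice) : Differentiable ℂ (sigmaFactor L ω) := by
  unfold sigmaFactor
  split_ifs <;> fun_prop

theorem sigmaFactor_ne_zero {z : ℂ} (hz : z ∉ L.lattice ∨ z = 0) (ω : L.lattice) :
    sigmaFactor L ω z ≠ 0 := by
  unfold sigmaFactor
  split_ifs with h
  · exact one_ne_zero
  refine mul_ne_zero (fun h0 ↦ ?_) (Complex.exp_ne_zero _)
  have h1 : z = ω := ((div_eq_one_iff_eq h).mp (sub_eq_zero.mp h0).symm)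
  rcases hz with hz | hz
  · exact hz (h1 ▸ ω.2)
  · exact h (h1.symm.trans hz)

theorem norm_sigmaFactor_sub_one_le {r : ℝ} {z : ℂ} (hz : ‖z‖ ≤ r) {ω : L.lattice}
    (hω : r ≤ ‖(ω : ℂ)‖) :
    ‖sigmaFactor L ω z - 1‖ ≤ Real.exp 2 * r ^ 3 * ‖ω‖ ^ (-3 : ℝ) := by
  have hr : 0 ≤ r := (norm_nonneg z).trans hz
  unfold sigmaFactor
  split_ifs with h
  · simp only [sub_self, norm_zero]
    positivity
  have hpos : 0 < ‖(ω : ℂ)‖ := norm_pos_iff.mpr h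
  have h1 : z / ω + z ^ 2 / (2 * (ω : ℂ) ^ 2) = z / ω + (z / ω) ^ 2 / 2 := by
    field_simp
  rw [h1]
  have h2 : ‖z / ω‖ ≤ 1 := by
    rw [norm_div, div_le_one hpos]
    exact hz.trans hω
  refine (norm_primaryFactor_two_sub_one_le h2).trans ?_
  rw [mul_assoc]
  gcongr
  rw [Submodule.coe_norm, Real.rpow_neg hpos.le, norm_div, div_pow, div_eq_mul_inv]
  norm_cast
  gcongr

theorem summable_lattice_rpow (c : ℝ) :
    Summable fun ω : L.lattice ↦ c * ‖ω‖ ^ (-3 : ℝ) :=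
  (ZLattice.summable_norm_rpow _ _ (by simp; norm_num)).mul_left _

theorem eventually_le_norm_lattice (r : ℝ) :
    ∀ᶠ ω : L.lattice in cofinite, r ≤ ‖(ω : ℂ)‖ := by
  refine (isCompact_iff_finite.mp (isCompact_closedBall (0 : L.lattice) r)).subset ?_
  intro ω hω
  have : ‖(ω : ℂ)‖ < r := by simpa using hω
  simpa using this.le

theorem hasProdLocallyUniformlyOn_sigmaProd (r : ℝ) :
    HasProdLocallyUniformlyOn (sigmaFactor L) (sigmaProd L) (Metric.ball 0 r) := by
  have := Summable.hasProdLocallyUniformlyOn_one_add (K := Metric.ball (0 : ℂ) r)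
    (f := fun ω z ↦ sigmaFactor L ω z - 1) Metric.isOpen_ball
    (summable_lattice_rpow L (Real.exp 2 * r ^ 3))
    ((eventually_le_norm_lattice L r).mono fun ω hω z hz ↦
      norm_sigmaFactor_sub_one_le L (by simpa using (mem_ball_zero_iff.mp hz).le) hω)
    (fun ω ↦ ((differentiable_sigmaFactor L ω).sub_const 1).continuous.continuousOn)
  simpa using! this

theorem tendstoLocallyUniformlyOn_sigmaProd (r : ℝ) :
    TendstoLocallyUniformlyOn (fun (s : Finset L.lattice) z ↦ ∏ ω ∈ s, sigmaFactor L ω z)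
      (sigmaProd L) atTop (Metric.ball 0 r) :=
  hasProdLocallyUniformlyOn_iff_tendstoLocallyUniformlyOn.mp
    (hasProdLocallyUniformlyOn_sigmaProd L r)

theorem differentiable_prod_sigmaFactor (s : Finset L.lattice) :
    Differentiable ℂ fun z ↦ ∏ ω ∈ s, sigmaFactor L ω z := by
  have := differentiable_sigmaFactor L
  fun_prop

theorem differentiable_sigmaProd : Differentiable ℂ (sigmaProd L) := fun z ↦ by
  have hz : z ∈ Metric.ball (0 : ℂ) (‖z‖ + 1) := by simp
  exact ((tendstoLocallyUniformlyOn_sigmaProd L (‖z‖ + 1)).differentiableOn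
    (.of_forall fun s ↦ (differentiable_prod_sigmaFactor L s).differentiableOn)
    Metric.isOpen_ball).differentiableAt (Metric.isOpen_ball.mem_nhds hz)

theorem differentiable_weierstrassSigma : Differentiable ℂ (weierstrassSigma L) :=
  differentiable_id.mul (differentiable_sigmaProd L)

theorem sigmaProd_ne_zero {z : ℂ} (hz : z ∉ L.lattice ∨ z = 0) : sigmaProd L z ≠ 0 := by
  have := tprod_one_add_ne_zero_of_summable (f := fun ω ↦ sigmaFactor L ω z - 1)
    (fun ω ↦ by simpa using sigmaFactor_ne_zero L hz ω)
    (Summable.of_norm_bounded_eventually (summable_lattice_rpow L (Real.exp 2 * ‖z‖ ^ 3))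
      ((eventually_le_norm_lattice L ‖z‖).mono fun ω hω ↦ by
        simpa using norm_sigmaFactor_sub_one_le L le_rfl hω))
  simpa [sigmaProd] using this

theorem sigmaProd_eq_zero {ω : L.lattice} (h : (ω : ℂ) ≠ 0) : sigmaProd L ω = 0 := by
  unfold sigmaProd
  refine tprod_of_exists_eq_zero ⟨ω, ?_⟩
  simp [sigmaFactor, h]

@[simp] theorem weierstrassSigma_zero : weierstrassSigma L 0 = 0 := by
  simp [weierstrassSigma_eq]

theorem weierstrassSigma_eq_zero_iff {z : ℂ} : weierstrassSigma L z = 0 ↔ z ∈ L.lattice := by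
  rw [weierstrassSigma_eq, mul_eq_zero]
  constructor
  · rintro (rfl | h)
    · exact zero_mem _
    · by_contra hz
      exact sigmaProd_ne_zero L (Or.inl hz) h
  · intro h
    by_cases hz : z = 0
    · exact Or.inl hz
    · exact Or.inr (sigmaProd_eq_zero L (ω := ⟨z, h⟩) hz)

theorem weierstrassSigma_ne_zero {z : ℂ} (hz : z ∉ L.lattice) : weierstrassSigma L z ≠ 0 :=
  mt (weierstrassSigma_eq_zero_iff L).mp hz

@[simp] theorem weierstrassSigma_neg (z : ℂ) : weierstrassSigma L (-z) = -weierstrassSigma L z := by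
  rw [weierstrassSigma_eq, weierstrassSigma_eq, neg_mul]
  congr 2
  unfold sigmaProd
  rw [← (Equiv.neg L.lattice).tprod_eq]
  refine tprod_congr fun ω ↦ ?_
  simp [sigmaFactor]

theorem deriv_weierstrassSigma_zero_ne_zero : deriv (weierstrassSigma L) 0 ≠ 0 := by
  have h : HasDerivAt (weierstrassSigma L) (1 * sigmaProd L 0 + 0 * deriv (sigmaProd L) 0) 0 :=
    (hasDerivAt_id 0).mul (differentiable_sigmaProd L 0).hasDerivAt
  rw [h.deriv]
  simpa using sigmaProd_ne_zero L (Or.inr rfl)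

theorem countable_lattice : (L.lattice : Set ℂ).Countable :=
  Set.countable_coe_iff.mp (L.latticeEquivProd.toEquiv.countable_iff.mpr inferInstance)

theorem isOpen_compl_lattice : IsOpen ((L.lattice : Set ℂ)ᶜ) := L.isClosed_lattice.isOpen_compl

theorem isPreconnected_compl_lattice : IsPreconnected ((L.lattice : Set ℂ)ᶜ) :=
  ((countable_lattice L).isPathConnected_compl_of_one_lt_rank
    (by simp)).isConnected.isPreconnected

theorem deriv_logDeriv {f : ℂ → ℂ} {z : ℂ} (hf : DifferentiableAt ℂ f z)
    (hf' : DifferentiableAt ℂ (deriv f) z) (hz : f z ≠ 0) :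
    deriv (logDeriv f) z = deriv (deriv f) z / f z - (deriv f z / f z) ^ 2 := by
  have := hf'.hasDerivAt.div hf.hasDerivAt hz
  rw [show logDeriv f = deriv f / f from rfl, this.deriv]
  field_simp

theorem logDeriv_sigmaFactor {ω : L.lattice} (h : (ω : ℂ) ≠ 0) {z : ℂ} (hz : z ≠ ω) :
    logDeriv (sigmaFactor L ω) z = 1 / (z - ω) + 1 / ω + z / (ω : ℂ) ^ 2 := by
  have hsub : z - ω ≠ 0 := sub_ne_zero.mpr hz
  have hsub' : (ω : ℂ) - z ≠ 0 := sub_ne_zero.mpr hz.symm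
  have h1 : HasDerivAt (fun z : ℂ ↦ z / ω + z ^ 2 / (2 * (ω : ℂ) ^ 2)) (1 / ω + z / ω ^ 2) z := by
    have := ((hasDerivAt_id z).div_const (ω : ℂ)).add
      (((hasDerivAt_id z).pow 2).div_const (2 * (ω : ℂ) ^ 2))
    refine this.congr_deriv ?_
    simp only [id]
    field_simp
    push_cast
    ring
  have h2 := (((hasDerivAt_id z).div_const (ω : ℂ)).const_sub 1).mul h1.cexp
  have h3 : sigmaFactor L ω = fun z ↦
      (1 - z / ω) * Complex.exp (z / ω + z ^ 2 / (2 * (ω : ℂ) ^ 2)) := by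
    funext z
    simp [sigmaFactor, h]
  have h4 : (1 - z / ω : ℂ) ≠ 0 := by
    rw [show (1 - z / ω : ℂ) = (ω - z) / ω by field_simp]
    exact div_ne_zero hsub' h
  rw [logDeriv_apply, h3]
  have h5 : deriv (fun z : ℂ ↦
      (1 - z / ω) * Complex.exp (z / ω + z ^ 2 / (2 * (ω : ℂ) ^ 2))) z = _ := h2.deriv
  rw [h5]
  have hexp := Complex.exp_ne_zero (z / ω + z ^ 2 / (2 * (ω : ℂ) ^ 2))
  simp only [id]
  rw [div_eq_iff (mul_ne_zero h4 hexp)]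
  field_simp
  ring

theorem hasDerivAt_logDeriv_sigmaFactor (ω : L.lattice) {z : ℂ} (hz : z ∉ L.lattice) :
    HasDerivAt (logDeriv (sigmaFactor L ω))
      (-(if (ω : ℂ) = ((0 : L.lattice) : ℂ) then 0 else (1 / (z - ω) ^ 2 - 1 / (ω : ℂ) ^ 2))) z := by
  by_cases h : (ω : ℂ) = 0
  · have h1 : sigmaFactor L ω = fun _ ↦ 1 := by
      funext z
      simp [sigmaFactor, h]
    rw [h1, logDeriv_const]
    simp only [h, ZeroMemClass.coe_zero, if_true, neg_zero]
    exact hasDerivAt_const z (0 : ℂ)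
  have hzω : z ≠ ω := fun e ↦ hz (e ▸ ω.2)
  have hsub : z - ω ≠ 0 := sub_ne_zero.mpr hzω
  have h1 : HasDerivAt (fun z : ℂ ↦ 1 / (z - ω) + 1 / ω + z / (ω : ℂ) ^ 2)
      (-(1 / (z - ω) ^ 2 - 1 / (ω : ℂ) ^ 2)) z := by
    have := ((((hasDerivAt_id z).sub_const (ω : ℂ)).inv hsub).add_const (1 / (ω : ℂ))).add
      ((hasDerivAt_id z).div_const ((ω : ℂ) ^ 2))
    refine (this.congr_deriv ?_).congr_of_eventuallyEq (.of_forall fun x ↦ ?_)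
    · simp only [id]
      ring
    · simp
  rw [if_neg (by simpa using h)]
  refine h1.congr_of_eventuallyEq ?_
  filter_upwards [isOpen_ne.mem_nhds hzω] with x hx
  exact logDeriv_sigmaFactor L h hx

/-- `(log σ)'' = -℘`. The second logarithmic derivatives of the finite partial products converge,
since locally uniform convergence passes to derivatives; they are the partial sums of `-℘`. -/
theorem deriv_logDeriv_weierstrassSigma {z : ℂ} (hz : z ∉ L.lattice) :
    deriv (logDeriv (weierstrassSigma L)) z = -L.weierstrassP z := by
  have hz0 : z ≠ 0 := fun h ↦ hz (h ▸ zero_mem _)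
  have hopen := isOpen_compl_lattice L
  have hnz := sigmaProd_ne_zero L (Or.inl hz)
  have hT := tendstoLocallyUniformlyOn_sigmaProd L (‖z‖ + 1)
  have hball : z ∈ Metric.ball (0 : ℂ) (‖z‖ + 1) := by simp
  have hd := differentiable_prod_sigmaFactor L
  have hT1 := hT.deriv (.of_forall fun s ↦ (hd s).differentiableOn) Metric.isOpen_ball
  have hT2 := hT1.deriv (.of_forall fun s ↦ ((hd s).deriv).differentiableOn) Metric.isOpen_ball
  have hlim : Tendsto
      (fun s : Finset L.lattice ↦ deriv (logDeriv fun z ↦ ∏ ω ∈ s, sigmaFactor L ω z) z) atTop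
      (𝓝 (deriv (logDeriv (sigmaProd L)) z)) := by
    rw [deriv_logDeriv (differentiable_sigmaProd L z) ((differentiable_sigmaProd L).deriv z) hnz]
    refine (((hT2.tendsto_at hball).div (hT.tendsto_at hball) hnz).sub
      (((hT1.tendsto_at hball).div (hT.tendsto_at hball) hnz).pow 2)).congr fun s ↦ ?_
    rw [deriv_logDeriv (hd s z) ((hd s).deriv z)
      (Finset.prod_ne_zero_iff.mpr fun ω _ ↦ sigmaFactor_ne_zero L (Or.inl hz) ω)]
    rfl
  have hfin : ∀ s : Finset L.lattice,
      deriv (logDeriv fun z ↦ ∏ ω ∈ s, sigmaFactor L ω z) z =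
        -∑ ω ∈ s, if (ω : ℂ) = ((0 : L.lattice) : ℂ) then 0
          else (1 / (z - ω) ^ 2 - 1 / (ω : ℂ) ^ 2) := fun s ↦ by
    rw [← Finset.sum_neg_distrib]
    refine HasDerivAt.deriv ((HasDerivAt.fun_sum fun ω _ ↦
      hasDerivAt_logDeriv_sigmaFactor L ω hz).congr_of_eventuallyEq ?_)
    filter_upwards [hopen.mem_nhds hz] with x hx
    exact logDeriv_prod (fun ω _ ↦ sigmaFactor_ne_zero L (Or.inl hx) ω)
      fun ω _ ↦ differentiable_sigmaFactor L ω x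
  have hprod : deriv (logDeriv (sigmaProd L)) z = -L.weierstrassPExcept (0 : L.lattice) z := by
    refine tendsto_nhds_unique hlim ?_
    simp_rw [hfin]
    exact Tendsto.neg (L.hasSum_weierstrassPExcept ((0 : L.lattice) : ℂ) z)
  have hev : logDeriv (weierstrassSigma L) =ᶠ[𝓝 z] fun x ↦ x⁻¹ + logDeriv (sigmaProd L) x := by
    filter_upwards [hopen.mem_nhds hz] with x hx
    have hx0 : x ≠ 0 := fun h ↦ hx (h ▸ zero_mem _)
    have := logDeriv_mul (f := id) (g := sigmaProd L) x hx0 (sigmaProd_ne_zero L (Or.inl hx))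
      differentiableAt_id (differentiable_sigmaProd L x)
    rw [logDeriv_id, one_div] at this
    exact this
  have hdl : DifferentiableAt ℂ (logDeriv (sigmaProd L)) z :=
    ((differentiable_sigmaProd L).deriv z).div (differentiable_sigmaProd L z) hnz
  rw [hev.deriv_eq, deriv_fun_add (differentiableAt_inv hz0) hdl, hprod, deriv_inv,
    L.weierstrassPExcept_def]
  simp

theorem add_mem_lattice_iff {z : ℂ} (ω : L.lattice) : z + ω ∈ L.lattice ↔ z ∈ L.lattice :=
  L.lattice.toAddSubgroup.add_mem_cancel_right ω.2

/-- Quasi-periodicity of the sigma function: `log σ(z + ω) - log σ(z)` is affine in `z`, since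
its second derivative is `℘(z) - ℘(z + ω) = 0`. -/
theorem exists_weierstrassSigma_add (ω : L.lattice) :
    ∃ c α : ℂ, c ≠ 0 ∧ ∀ z, weierstrassSigma L (z + ω) =
      c * Complex.exp (α * z) * weierstrassSigma L z := by
  have hopen := isOpen_compl_lattice L
  have hconn := isPreconnected_compl_lattice L
  have hσ := differentiable_weierstrassSigma L
  have hne : ∀ x ∈ ((L.lattice : Set ℂ)ᶜ), weierstrassSigma L x ≠ 0 :=
    fun x hx ↦ weierstrassSigma_ne_zero L hx
  have hshift : ∀ x ∈ ((L.lattice : Set ℂ)ᶜ), x + ω ∈ ((L.lattice : Set ℂ)ᶜ) :=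
    fun x hx h ↦ hx ((add_mem_lattice_iff L ω).mp h)
  have hdl : ∀ x ∈ ((L.lattice : Set ℂ)ᶜ), DifferentiableAt ℂ (logDeriv (weierstrassSigma L)) x :=
    fun x hx ↦ (hσ.deriv x).div (hσ x) (hne x hx)
  have hdl' : ∀ x ∈ ((L.lattice : Set ℂ)ᶜ), HasDerivAt
      (fun x ↦ logDeriv (weierstrassSigma L) (x + ω) - logDeriv (weierstrassSigma L) x) 0 x := by
    intro x hx
    have h1 := (hdl _ (hshift x hx)).hasDerivAt.comp_add_const x (ω : ℂ)
    have h2 := h1.sub (hdl x hx).hasDerivAt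
    refine h2.congr_deriv ?_
    rw [deriv_logDeriv_weierstrassSigma L hx, deriv_logDeriv_weierstrassSigma L (hshift x hx),
      L.weierstrassP_add_coe]
    ring
  obtain ⟨α, hα⟩ : ∃ α, ∀ x ∈ ((L.lattice : Set ℂ)ᶜ),
      logDeriv (weierstrassSigma L) (x + ω) - logDeriv (weierstrassSigma L) x = α :=
    hopen.exists_is_const_of_deriv_eq_zero hconn
      (fun x hx ↦ (hdl' x hx).differentiableAt.differentiableWithinAt)
      fun x hx ↦ (hdl' x hx).deriv
  have hexp : ∀ x, HasDerivAt (fun z ↦ Complex.exp (α * z)) (Complex.exp (α * x) * α) x :=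
    fun x ↦ by simpa using ((hasDerivAt_id x).const_mul α).cexp
  have hlog : Set.EqOn (logDeriv fun z ↦ weierstrassSigma L (z + ω))
      (logDeriv fun z ↦ Complex.exp (α * z) * weierstrassSigma L z) ((L.lattice : Set ℂ)ᶜ) := by
    intro x hx
    rw [logDeriv_mul (f := fun z ↦ Complex.exp (α * z)) x (Complex.exp_ne_zero _) (hne x hx)
        (hexp x).differentiableAt (hσ x),
      logDeriv_apply (fun z ↦ Complex.exp (α * z)), (hexp x).deriv,
      mul_div_cancel_left₀ _ (Complex.exp_ne_zero _), ← hα x hx, logDeriv_apply,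
      deriv_comp_add_const]
    simp [logDeriv_apply]
  obtain ⟨c, hc, h⟩ := (logDeriv_eqOn_iff
    (f := fun z ↦ weierstrassSigma L (z + ω))
    (g := fun z ↦ Complex.exp (α * z) * weierstrassSigma L z)
    (hσ.comp (differentiable_id.add_const _)).differentiableOn
    (fun x _ ↦ ((hexp x).differentiableAt.mul (hσ x)).differentiableWithinAt) hopen hconn
    (fun x hx ↦ mul_ne_zero (Complex.exp_ne_zero _) (hne x hx))
    (fun x hx ↦ hne _ (hshift x hx))).mp hlog
  refine ⟨c, α, hc, fun z ↦ ?_⟩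
  by_cases hz : z ∈ L.lattice
  · rw [(weierstrassSigma_eq_zero_iff L).mpr hz,
      (weierstrassSigma_eq_zero_iff L).mpr ((add_mem_lattice_iff L ω).mpr hz), mul_zero]
  · have := h hz
    simpa [mul_assoc] using this

/-- The zeros of the sigma function are simple. -/
theorem deriv_weierstrassSigma_ne_zero {z : ℂ} (hz : z ∈ L.lattice) :
    deriv (weierstrassSigma L) z ≠ 0 := by
  obtain ⟨c, α, hc, h⟩ := exists_weierstrassSigma_add L ⟨z, hz⟩
  have h1 : deriv (fun x ↦ weierstrassSigma L (x + z)) 0 = deriv (weierstrassSigma L) z := by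
    rw [deriv_comp_add_const, zero_add]
  have h2 : (fun x ↦ weierstrassSigma L (x + z)) =
      fun x ↦ c * Complex.exp (α * x) * weierstrassSigma L x := funext h
  have h3 : DifferentiableAt ℂ (fun x ↦ c * Complex.exp (α * x)) 0 := by fun_prop
  rw [← h1, h2, deriv_fun_mul h3 (differentiable_weierstrassSigma L 0)]
  simpa using ⟨hc, deriv_weierstrassSigma_zero_ne_zero L⟩

end Sigma

/-! ### The addition identity of the sigma function -/

section Addition

open Filter Topology

/-- An entire function vanishing at the zeros of an entire function `G` with only simple zeros
is divisible by `G`. -/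
theorem exists_differentiable_eq_mul_of_simple_zeros {F G : ℂ → ℂ} (hF : Differentiable ℂ F)
    (hG : Differentiable ℂ G) (h : ∀ z, G z = 0 → F z = 0 ∧ deriv G z ≠ 0) :
    ∃ H : ℂ → ℂ, Differentiable ℂ H ∧ ∀ z, F z = H z * G z := by
  classical
  have hslope : ∀ {f : ℂ → ℂ}, Differentiable ℂ f → ∀ a, Differentiable ℂ (dslope f a) :=
    fun hf a ↦ differentiableOn_univ.mp
      ((Complex.differentiableOn_dslope univ_mem).mpr hf.differentiableOn)
  refine ⟨fun z ↦ if G z = 0 then deriv F z / deriv G z else F z / G z, fun a ↦ ?_, fun z ↦ ?_⟩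
  · by_cases ha : G a = 0
    · obtain ⟨hFa, hGa⟩ := h a ha
      have hGs : dslope G a a ≠ 0 := by rwa [dslope_same]
      refine ((hslope hF a a).div (hslope hG a a) hGs).congr_of_eventuallyEq ?_
      filter_upwards [(hslope hG a).continuous.continuousAt.eventually_ne hGs] with z hz
      by_cases hza : z = a
      · subst hza
        simp [ha]
      · have hsub : z - a ≠ 0 := sub_ne_zero.mpr hza
        have e1 : F z = (z - a) * dslope F a z := by
          have := sub_smul_dslope F a z
          rw [hFa, sub_zero] at this
          simpa using this.symm
        have e2 : G z = (z - a) * dslope G a z := by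
          have := sub_smul_dslope G a z
          rw [ha, sub_zero] at this
          simpa using this.symm
        have hGz : G z ≠ 0 := e2 ▸ mul_ne_zero hsub hz
        rw [if_neg hGz, e1, e2, mul_div_mul_left _ _ hsub]
        rfl
    · refine ((hF a).div (hG a) ha).congr_of_eventuallyEq ?_
      filter_upwards [hG.continuous.continuousAt.eventually_ne ha] with z hz
      simp [hz]
  · dsimp only
    split_ifs with hz
    · rw [hz, (h z hz).1, mul_zero]
    · rw [div_mul_cancel₀ _ hz]

variable (L : PeriodPair)

theorem dense_compl_sub_mem_lattice (a b : ℂ) :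
    Dense {z : ℂ | z + a ∉ L.lattice ∧ z + b ∉ L.lattice} := by
  have hc : ∀ a : ℂ, {z : ℂ | z + a ∈ L.lattice}.Countable := fun a ↦
    (countable_lattice L).preimage (add_left_injective a)
  convert ((hc a).union (hc b)).dense_compl ℝ using 1
  ext z
  simp

/-- A product `σ(z + p) σ(z + q)` transforms under a period by a factor that depends on `p` and
`q` only through `p + q`. -/
theorem exists_multiplier_weierstrassSigma_mul (s : ℂ) (ω : L.lattice) :
    ∃ k : ℂ → ℂ, (∀ z, k z ≠ 0) ∧ ∀ p q z : ℂ, p + q = s →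
      weierstrassSigma L (z + ω + p) * weierstrassSigma L (z + ω + q) =
        k z * (weierstrassSigma L (z + p) * weierstrassSigma L (z + q)) := by
  obtain ⟨c, α, hc, h⟩ := exists_weierstrassSigma_add L ω
  refine ⟨fun z ↦ c ^ 2 * Complex.exp (α * (2 * z + s)),
    fun z ↦ mul_ne_zero (pow_ne_zero _ hc) (Complex.exp_ne_zero _), fun p q z hpq ↦ ?_⟩
  dsimp only
  rw [show z + ω + p = z + p + ω by ring, show z + ω + q = z + q + ω by ring, h, h, ← hpq,
    show α * (2 * z + (p + q)) = α * (z + p) + α * (z + q) by ring, Complex.exp_add]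
  ring

/-- A theta function of degree two with the multipliers of `σ(z) σ(z + s)` that also vanishes at
`0` and `-s` is proportional to it: the quotient is entire and doubly periodic. -/
theorem exists_eq_const_mul_weierstrassSigma_mul {s : ℂ} (hs : s ∉ L.lattice) {F : ℂ → ℂ}
    (hF : Differentiable ℂ F) (h0 : F 0 = 0) (h1 : F (-s) = 0)
    (hq : ∀ ω : L.lattice, ∃ k : ℂ → ℂ, (∀ z, k z ≠ 0) ∧
      (∀ z, F (z + ω) = k z * F z) ∧
      ∀ z, weierstrassSigma L (z + ω) * weierstrassSigma L (z + ω + s) =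
        k z * (weierstrassSigma L z * weierstrassSigma L (z + s))) :
    ∃ K : ℂ, ∀ z, F z = K * (weierstrassSigma L z * weierstrassSigma L (z + s)) := by
  have hσ := differentiable_weierstrassSigma L
  have hσs : Differentiable ℂ fun z ↦ weierstrassSigma L (z + s) :=
    hσ.comp (differentiable_id.add_const s)
  have hzero : ∀ ω : L.lattice, ∀ a, F a = 0 → F (a + ω) = 0 := fun ω a ha ↦ by
    obtain ⟨k, -, hk, -⟩ := hq ω
    rw [hk, ha, mul_zero]
  obtain ⟨H, hH, hFH⟩ := exists_differentiable_eq_mul_of_simple_zeros hF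
    (G := fun z ↦ weierstrassSigma L z * weierstrassSigma L (z + s)) (hσ.mul hσs) (by
      intro z hz
      have hder : deriv (fun z ↦ weierstrassSigma L z * weierstrassSigma L (z + s)) z =
          deriv (weierstrassSigma L) z * weierstrassSigma L (z + s) +
            weierstrassSigma L z * deriv (weierstrassSigma L) (z + s) := by
        rw [deriv_fun_mul (hσ z) (hσs z), deriv_comp_add_const]
      rw [hder]
      rcases mul_eq_zero.mp hz with h | h
      · have hzl := (weierstrassSigma_eq_zero_iff L).mp h
        refine ⟨by simpa using hzero ⟨z, hzl⟩ 0 h0, ?_⟩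
        rw [h, zero_mul, add_zero]
        refine mul_ne_zero (deriv_weierstrassSigma_ne_zero L hzl)
          (weierstrassSigma_ne_zero L fun hmem ↦ hs ?_)
        simpa using sub_mem hmem hzl
      · have hzl := (weierstrassSigma_eq_zero_iff L).mp h
        refine ⟨by simpa using hzero ⟨z + s, hzl⟩ (-s) h1, ?_⟩
        rw [h, mul_zero, zero_add]
        refine mul_ne_zero (weierstrassSigma_ne_zero L fun hmem ↦ hs ?_)
          (deriv_weierstrassSigma_ne_zero L hzl)
        simpa using sub_mem hzl hmem)
  have hper : ∀ z w, w ∈ L.lattice → H (z + w) = H z := by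
    intro z w hw
    obtain ⟨k, hk, hk1, hk2⟩ := hq ⟨w, hw⟩
    have heq : (fun z ↦ H (z + w)) = H := by
      refine Continuous.ext_on (dense_compl_sub_mem_lattice L 0 s)
        (hH.continuous.comp (continuous_add_const w)) hH.continuous fun x hx ↦ ?_
      have hne : weierstrassSigma L x * weierstrassSigma L (x + s) ≠ 0 :=
        mul_ne_zero (weierstrassSigma_ne_zero L (by simpa using hx.1))
          (weierstrassSigma_ne_zero L hx.2)
      have e := hk1 x
      rw [hFH, hFH, hk2] at e
      refine mul_right_cancel₀ (mul_ne_zero (hk x) hne) ?_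
      rw [e]
      ring
    exact congrFun heq z
  refine ⟨H 0, fun z ↦ ?_⟩
  rw [hFH, hH.apply_eq_apply_of_bounded
    (IsZLattice.isCompact_range_of_periodic L.lattice _ hH.continuous hper).isBounded z 0]

/-- The three-term (Weierstrass) identity of the sigma function, in the form of the elliptic
Cauchy determinant of order two. -/
theorem weierstrassSigma_three_term (ξ x₁ x₂ y₁ y₂ : ℂ) (h₁ : x₁ + y₁ ∉ L.lattice) :
    weierstrassSigma L (ξ + x₁ + y₁) * weierstrassSigma L (ξ + x₂ + y₂) *
        (weierstrassSigma L (x₁ + y₂) * weierstrassSigma L (x₂ + y₁)) -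
      weierstrassSigma L (ξ + x₁ + y₂) * weierstrassSigma L (ξ + x₂ + y₁) *
        (weierstrassSigma L (x₁ + y₁) * weierstrassSigma L (x₂ + y₂)) =
    weierstrassSigma L ξ * weierstrassSigma L (ξ + x₁ + x₂ + y₁ + y₂) *
      (weierstrassSigma L (x₁ - x₂) * weierstrassSigma L (y₁ - y₂)) := by
  have hσ := differentiable_weierstrassSigma L
  have hσc := hσ.continuous
  have hσa : ∀ a, Differentiable ℂ fun z ↦ weierstrassSigma L (z + a) := fun a ↦
    hσ.comp (differentiable_id.add_const a)
  -- Both sides are continuous in `y₂`, so finitely many bad cosets may be avoided.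
  suffices H : ∀ y₂ : ℂ, y₂ + x₂ ∉ L.lattice ∧ y₂ + (x₁ + x₂ + y₁) ∉ L.lattice →
      weierstrassSigma L (ξ + x₁ + y₁) * weierstrassSigma L (ξ + x₂ + y₂) *
        (weierstrassSigma L (x₁ + y₂) * weierstrassSigma L (x₂ + y₁)) -
      weierstrassSigma L (ξ + x₁ + y₂) * weierstrassSigma L (ξ + x₂ + y₁) *
        (weierstrassSigma L (x₁ + y₁) * weierstrassSigma L (x₂ + y₂)) =
      weierstrassSigma L ξ * weierstrassSigma L (ξ + x₁ + x₂ + y₁ + y₂) *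
        (weierstrassSigma L (x₁ - x₂) * weierstrassSigma L (y₁ - y₂)) by
    exact congrFun (Continuous.ext_on (dense_compl_sub_mem_lattice L x₂ (x₁ + x₂ + y₁))
      (by fun_prop) (by fun_prop) H) y₂
  clear y₂
  rintro y₂ ⟨h₂, hs⟩
  let F : ℂ → ℂ := fun z ↦
    weierstrassSigma L (z + (x₁ + y₁)) * weierstrassSigma L (z + (x₂ + y₂)) *
        (weierstrassSigma L (x₁ + y₂) * weierstrassSigma L (x₂ + y₁)) -
      weierstrassSigma L (z + (x₁ + y₂)) * weierstrassSigma L (z + (x₂ + y₁)) *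
        (weierstrassSigma L (x₁ + y₁) * weierstrassSigma L (x₂ + y₂))
  have hF : Differentiable ℂ F :=
    (((hσa _).mul (hσa _)).mul_const _).sub (((hσa _).mul (hσa _)).mul_const _)
  have hneg : ∀ a b : ℂ, a = -b → weierstrassSigma L a = -weierstrassSigma L b := by
    rintro _ b rfl
    exact weierstrassSigma_neg L b
  obtain ⟨K, hK⟩ := exists_eq_const_mul_weierstrassSigma_mul L hs hF
    (by
      simp only [F, zero_add]
      ring)
    (by
      simp only [F]
      rw [hneg (-(y₂ + (x₁ + x₂ + y₁)) + (x₁ + y₁)) (x₂ + y₂) (by ring),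
        hneg (-(y₂ + (x₁ + x₂ + y₁)) + (x₂ + y₂)) (x₁ + y₁) (by ring),
        hneg (-(y₂ + (x₁ + x₂ + y₁)) + (x₁ + y₂)) (x₂ + y₁) (by ring),
        hneg (-(y₂ + (x₁ + x₂ + y₁)) + (x₂ + y₁)) (x₁ + y₂) (by ring)]
      ring)
    (fun ω ↦ by
      obtain ⟨k, hk, h⟩ :=
        exists_multiplier_weierstrassSigma_mul L (y₂ + (x₁ + x₂ + y₁)) ω
      refine ⟨k, hk, fun z ↦ ?_, fun z ↦ ?_⟩
      · simp only [F]
        rw [h (x₁ + y₁) (x₂ + y₂) z (by ring), h (x₁ + y₂) (x₂ + y₁) z (by ring)]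
        ring
      · simpa using h 0 (y₂ + (x₁ + x₂ + y₁)) z (by ring))
  -- The constant is found at `z = -(x₁ + y₁)`.
  have hK' : K = weierstrassSigma L (x₁ - x₂) * weierstrassSigma L (y₁ - y₂) := by
    have e := hK (-(x₁ + y₁))
    simp only [F] at e
    rw [neg_add_cancel, weierstrassSigma_zero,
      hneg (-(x₁ + y₁) + (x₁ + y₂)) (y₁ - y₂) (by ring),
      hneg (-(x₁ + y₁) + (x₂ + y₁)) (x₁ - x₂) (by ring),
      show -(x₁ + y₁) + (y₂ + (x₁ + x₂ + y₁)) = x₂ + y₂ by ring,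
      weierstrassSigma_neg] at e
    have n1 := weierstrassSigma_ne_zero L h₁
    have n2 : weierstrassSigma L (x₂ + y₂) ≠ 0 :=
      weierstrassSigma_ne_zero L (by rwa [add_comm] at h₂)
    refine mul_right_cancel₀ (mul_ne_zero n1 n2) ?_
    linear_combination e
  have e := hK ξ
  simp only [F] at e
  rw [hK'] at e
  simp only [← add_assoc] at e
  rw [e, show ξ + y₂ + x₁ + x₂ + y₁ = ξ + x₁ + x₂ + y₁ + y₂ by ring]
  ring

/-! ### The elliptic Cauchy determinant -/

/-- The **Frobenius determinant formula**, cleared of the denominators `σ(ξ)` so that both sides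
are entire in `ξ`. Elimination with the upper left entry as pivot reproduces the matrix with one
row and column less and with `ξ + x₀ + y₀` in place of `ξ`, by the three-term identity. -/
theorem det_weierstrassSigma_div {n : ℕ} (ξ : ℂ) (x y : Fin (n + 1) → ℂ)
    (hxy : ∀ i j, x i + y j ∉ L.lattice) :
    (Matrix.of fun i j ↦ weierstrassSigma L (ξ + x i + y j) / weierstrassSigma L (x i + y j)).det =
      weierstrassSigma L ξ ^ n * weierstrassSigma L (ξ + ∑ i, x i + ∑ j, y j) *
        ((∏ i, ∏ j ∈ Finset.Ioi i, weierstrassSigma L (x i - x j)) *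
          ∏ i, ∏ j ∈ Finset.Ioi i, weierstrassSigma L (y i - y j)) /
        ∏ i, ∏ j, weierstrassSigma L (x i + y j) := by
  have hσc := (differentiable_weierstrassSigma L).continuous
  have hne : ∀ i j, weierstrassSigma L (x i + y j) ≠ 0 := fun i j ↦
    weierstrassSigma_ne_zero L (hxy i j)
  induction n generalizing ξ with
  | zero => simp
  | succ n ih =>
    -- The pivot vanishes for a discrete set of `ξ` only.
    suffices H : ∀ ξ : ℂ, ξ + (x 0 + y 0) ∉ L.lattice ∧ ξ + (x 0 + y 0) ∉ L.lattice →
        (Matrix.of fun i j ↦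
          weierstrassSigma L (ξ + x i + y j) / weierstrassSigma L (x i + y j)).det =
        weierstrassSigma L ξ ^ (n + 1) * weierstrassSigma L (ξ + ∑ i, x i + ∑ j, y j) *
          ((∏ i, ∏ j ∈ Finset.Ioi i, weierstrassSigma L (x i - x j)) *
            ∏ i, ∏ j ∈ Finset.Ioi i, weierstrassSigma L (y i - y j)) /
          ∏ i, ∏ j, weierstrassSigma L (x i + y j) by
      refine congrFun (Continuous.ext_on
        (dense_compl_sub_mem_lattice L (x 0 + y 0) (x 0 + y 0)) ?_ ?_ H) ξ
      · refine Continuous.matrix_det ?_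
        refine continuous_matrix fun i j ↦ ?_
        simp only [Matrix.of_apply]
        fun_prop
      · fun_prop
    clear ξ
    rintro ξ ⟨hξ, -⟩
    have hp : weierstrassSigma L (ξ + x 0 + y 0) ≠ 0 :=
      weierstrassSigma_ne_zero L (by rwa [add_assoc])
    have hpivot : weierstrassSigma L (ξ + x 0 + y 0) / weierstrassSigma L (x 0 + y 0) ≠ 0 :=
      div_ne_zero hp (hne 0 0)
    have hsucc := ih (ξ + x 0 + y 0) (fun i ↦ x i.succ) (fun j ↦ y j.succ)
      (fun i j ↦ hxy _ _) (fun i j ↦ hne _ _)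
    have hentry : ∀ i j : Fin (n + 1),
        weierstrassSigma L (ξ + x i.succ + y j.succ) / weierstrassSigma L (x i.succ + y j.succ) -
          weierstrassSigma L (ξ + x i.succ + y 0) / weierstrassSigma L (x i.succ + y 0) /
            (weierstrassSigma L (ξ + x 0 + y 0) / weierstrassSigma L (x 0 + y 0)) *
            (weierstrassSigma L (ξ + x 0 + y j.succ) / weierstrassSigma L (x 0 + y j.succ)) =
        weierstrassSigma L ξ / weierstrassSigma L (ξ + x 0 + y 0) *
            weierstrassSigma L (x 0 - x i.succ) / weierstrassSigma L (x i.succ + y 0) *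
          (weierstrassSigma L (y 0 - y j.succ) / weierstrassSigma L (x 0 + y j.succ) *
          (weierstrassSigma L (ξ + x 0 + y 0 + x i.succ + y j.succ) /
            weierstrassSigma L (x i.succ + y j.succ))) := fun i j ↦ by
      have e := weierstrassSigma_three_term L ξ (x 0) (x i.succ) (y 0) (y j.succ) (hxy 0 0)
      rw [show ξ + x 0 + x i.succ + y 0 + y j.succ = ξ + x 0 + y 0 + x i.succ + y j.succ by ring]
        at e
      have n1 := hne i.succ j.succ
      have n2 := hne i.succ 0
      have n3 := hne 0 j.succ
      have n4 := hne 0 0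
      field_simp
      linear_combination e
    rw [det_succ_eq_pivot_mul_det _ hpivot]
    simp only [Matrix.of_apply, hentry]
    have hrow := Matrix.det_mul_column (fun i : Fin (n + 1) ↦
      weierstrassSigma L ξ / weierstrassSigma L (ξ + x 0 + y 0) *
        weierstrassSigma L (x 0 - x i.succ) / weierstrassSigma L (x i.succ + y 0))
      (Matrix.of fun i j : Fin (n + 1) ↦
        weierstrassSigma L (y 0 - y j.succ) / weierstrassSigma L (x 0 + y j.succ) *
          (weierstrassSigma L (ξ + x 0 + y 0 + x i.succ + y j.succ) /
            weierstrassSigma L (x i.succ + y j.succ)))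
    have hcol := Matrix.det_mul_row (fun j : Fin (n + 1) ↦
      weierstrassSigma L (y 0 - y j.succ) / weierstrassSigma L (x 0 + y j.succ))
      (Matrix.of fun i j : Fin (n + 1) ↦
          (weierstrassSigma L (ξ + x 0 + y 0 + x i.succ + y j.succ) /
            weierstrassSigma L (x i.succ + y j.succ)))
    simp only [Matrix.of_apply] at hrow hcol
    rw [hrow, hcol, hsucc]
    rw [Fin.prod_univ_succ (fun i ↦ ∏ j ∈ Finset.Ioi i, weierstrassSigma L (x i - x j)),
      Fin.prod_univ_succ (fun i ↦ ∏ j ∈ Finset.Ioi i, weierstrassSigma L (y i - y j))]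
    simp only [Fin.prod_Ioi_zero, Fin.prod_Ioi_succ]
    simp only [Fin.prod_univ_succ (n := n + 1), Fin.sum_univ_succ (n := n + 1),
      Finset.prod_mul_distrib, Finset.prod_div_distrib, Finset.prod_const, Finset.card_univ,
      Fintype.card_fin]
    have harg : ξ + x 0 + y 0 + ∑ i : Fin (n + 1), x i.succ + ∑ j : Fin (n + 1), y j.succ =
      ξ + (x 0 + ∑ i : Fin (n + 1), x i.succ) + (y 0 + ∑ j : Fin (n + 1), y j.succ) := by ring
    rw [harg]
    have m1 : ∏ i : Fin (n + 1), weierstrassSigma L (x i.succ + y 0) ≠ 0 :=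
      Finset.prod_ne_zero_iff.mpr fun i _ ↦ hne _ _
    have m2 : ∏ j : Fin (n + 1), weierstrassSigma L (x 0 + y j.succ) ≠ 0 :=
      Finset.prod_ne_zero_iff.mpr fun i _ ↦ hne _ _
    have m3 : ∏ i : Fin (n + 1), ∏ j : Fin (n + 1), weierstrassSigma L (x i.succ + y j.succ) ≠ 0 :=
      Finset.prod_ne_zero_iff.mpr fun i _ ↦ Finset.prod_ne_zero_iff.mpr fun j _ ↦ hne _ _
    have n4 := hne 0 0
    field_simp
    ring

/-- The **Frobenius determinant formula** `det (Φ_ξ(x_i + y_j))`. -/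
theorem det_lamePhi {n : ℕ} {ξ : ℂ} (hξ : ξ ∉ L.lattice) (x y : Fin n → ℂ)
    (hxy : ∀ i j, x i + y j ∉ L.lattice) :
    (Matrix.of fun i j ↦ lamePhi L ξ (x i + y j)).det =
      ((∏ i, ∏ j ∈ Finset.Ioi i, weierstrassSigma L (x i - x j)) *
          ∏ i, ∏ j ∈ Finset.Ioi i, weierstrassSigma L (y i - y j)) *
        (weierstrassSigma L (ξ + ∑ i, x i + ∑ j, y j) /
          (weierstrassSigma L ξ * ∏ i, ∏ j, weierstrassSigma L (x i + y j))) := by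
  have h0 := weierstrassSigma_ne_zero L hξ
  cases n with
  | zero => simp [h0]
  | succ n =>
    have hm : (Matrix.of fun i j ↦ lamePhi L ξ (x i + y j)) =
        (weierstrassSigma L ξ)⁻¹ • (Matrix.of fun i j ↦
          weierstrassSigma L (ξ + x i + y j) / weierstrassSigma L (x i + y j)) := by
      ext i j
      simp only [lamePhi, Matrix.of_apply, Matrix.smul_apply, smul_eq_mul]
      rw [show x i + y j + ξ = ξ + x i + y j by ring]
      field_simp
    rw [hm, Matrix.det_smul, det_weierstrassSigma_div L ξ x y hxy, Fintype.card_fin, inv_pow]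
    field_simp
    ring

end Addition

/-! ### Expansion of the τ-function -/

namespace EllipticSolitonData

variable {N N' : ℕ} (D : EllipticSolitonData N N')

/-- The exponential of `Ψ_ξ` is absorbed by the plane-wave factors. -/
theorem cauchy_apply (n m h : ℤ) (i : Fin N) (j : Fin N') :
    D.cauchy n m h i j =
      D.expTheta n m h i * (D.expEta n m h j * lamePhi D.L (D.xi n m h) (D.κ i + D.κ' j)) := by
  simp only [cauchy, bareCauchy, expTheta, expEta, lamePsi, Matrix.of_apply, zeta]
  rw [mul_add, Complex.exp_add]
  ring

theorem det_cauchy_submatrix (hκ : ∀ i j, D.κ i + D.κ' j ∉ D.L.lattice) {n m h : ℤ}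
    (hξ : D.xi n m h ∉ D.L.lattice) {r : ℕ} (i : Fin r ↪o Fin N) (j : Fin r ↪o Fin N') :
    ((D.cauchy n m h).submatrix i j).det =
      ((∏ a, D.expTheta n m h (i a)) * ∏ a, ∏ b ∈ Finset.Ioi a, D.expA (i a) (i b)) *
        ((∏ f, D.expEta n m h (j f)) * ∏ f, ∏ g ∈ Finset.Ioi f, D.expE (j f) (j g)) *
        D.sigmaRatio (D.xi n m h) i j := by
  -- Row and column factors are pulled out, which leaves the Frobenius determinant.
  have hm : (D.cauchy n m h).submatrix i j = Matrix.of fun a f ↦ D.expTheta n m h (i a) *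
      Matrix.of (fun a f ↦ D.expEta n m h (j f) *
        Matrix.of (fun a f ↦ lamePhi D.L (D.xi n m h) (D.κ (i a) + D.κ' (j f))) a f) a f := by
    ext a f
    exact D.cauchy_apply n m h (i a) (j f)
  rw [hm, Matrix.det_mul_column, Matrix.det_mul_row,
    det_lamePhi D.L hξ (fun a ↦ D.κ (i a)) (fun f ↦ D.κ' (j f)) fun a f ↦ hκ _ _]
  simp only [expA, expE, sigmaRatio, sigma]
  ring

/-- The expansion of `τ`, as a function of `ξ` and of the values of `e^{θ_i}` and `e^{η_l}`. -/
noncomputable def tauExpansion (x : ℂ) (t : Fin N → ℂ) (u : Fin N' → ℂ) : ℂ :=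
  1 + ∑ r ∈ Finset.Icc 1 (min N N'),
    ∑ i : Fin r ↪o Fin N,
      ((∏ a, t (i a)) * ∏ a, ∏ b ∈ Finset.Ioi a, D.expA (i a) (i b)) *
      ∑ j : Fin r ↪o Fin N',
        ((∏ f, u (j f)) * ∏ f, ∏ g ∈ Finset.Ioi f, D.expE (j f) (j g)) *
        (D.C.submatrix j i).det * D.sigmaRatio x i j

theorem tau_eq_tauExpansion (hκ : ∀ i j, D.κ i + D.κ' j ∉ D.L.lattice) {n m h : ℤ}
    (hξ : D.xi n m h ∉ D.L.lattice) :
    D.tau n m h = D.tauExpansion (D.xi n m h) (D.expTheta n m h) (D.expEta n m h) := by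
  rw [tau, tauExpansion, det_one_add_mul_eq_sum_minors]
  refine congrArg (1 + ·) (Finset.sum_congr rfl fun r _ ↦ Finset.sum_congr rfl fun i _ ↦ ?_)
  rw [Finset.mul_sum]
  refine Finset.sum_congr rfl fun j _ ↦ ?_
  rw [D.det_cauchy_submatrix hκ hξ]
  ring

/-- The expansion depends only on the periods, the rapidities and `C`. -/
theorem tauExpansion_congr {D₁ : EllipticSolitonData N N'} (hL : D₁.L = D.L) (hk : D₁.κ = D.κ)
    (hk' : D₁.κ' = D.κ') (hC : D₁.C = D.C) : D₁.tauExpansion = D.tauExpansion := by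
  funext x t u
  simp only [tauExpansion, expA, expE, sigmaRatio, sigma, hL, hk, hk', hC]

end EllipticSolitonData

theorem mainTheorem6 (N N' : ℕ) (D : EllipticSolitonData N N')
    (hκ : ∀ i j, D.κ i + D.κ' j ∉ D.L.lattice) :
    -- the expansion, with the values of the symbols `e^{θ_i}`, `e^{η_l}`, `e^{A_{ij}}`, `e^{E_{kl}}`
    (∀ n m h : ℤ, D.xi n m h ∉ D.L.lattice →
      D.tau n m h =
        1 + ∑ r ∈ Finset.Icc 1 (min N N'),
          ∑ i : Fin r ↪o Fin N,
            ((∏ a, D.expTheta n m h (i a)) * ∏ a, ∏ b ∈ Finset.Ioi a, D.expA (i a) (i b)) *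
            ∑ j : Fin r ↪o Fin N',
              ((∏ f, D.expEta n m h (j f)) * ∏ f, ∏ g ∈ Finset.Ioi f, D.expE (j f) (j g)) *
              (D.C.submatrix j i).det * D.sigmaRatio (D.xi n m h) i j) ∧
    -- the same expansion in exponential form, for any choice of the exponents (where they exist)
    (∀ n m h : ℤ, D.xi n m h ∉ D.L.lattice →
      ∀ (θ : Fin N → ℂ) (η : Fin N' → ℂ) (A : Fin N → Fin N → ℂ) (E : Fin N' → Fin N' → ℂ),
        (∀ i, Complex.exp (θ i) = D.expTheta n m h i) →
        (∀ j, Complex.exp (η j) = D.expEta n m h j) →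
        (∀ i i', i < i' → Complex.exp (A i i') = D.expA i i') →
        (∀ j j', j < j' → Complex.exp (E j j') = D.expE j j') →
        D.tau n m h =
          1 + ∑ r ∈ Finset.Icc 1 (min N N'),
            ∑ i : Fin r ↪o Fin N,
              Complex.exp (∑ a, θ (i a) + ∑ a, ∑ b ∈ Finset.Ioi a, A (i a) (i b)) *
              ∑ j : Fin r ↪o Fin N',
                Complex.exp (∑ f, η (j f) + ∑ f, ∑ g ∈ Finset.Ioi f, E (j f) (j g)) *
                (D.C.submatrix j i).det * D.sigmaRatio (D.xi n m h) i j) ∧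
    -- `n`, `m`, `h` enter only through `ξ`, the `θ_i` and the `η_l`: one function `F`, fixed by
    -- the periods, the rapidities and `C`, serves all lattice points and all the other parameters
    (∃ F : ℂ → (Fin N → ℂ) → (Fin N' → ℂ) → ℂ,
      ∀ D₁ : EllipticSolitonData N N',
        D₁.L = D.L → D₁.κ = D.κ → D₁.κ' = D.κ' → D₁.C = D.C →
        ∀ n m h : ℤ, D₁.xi n m h ∉ D₁.L.lattice →
          D₁.tau n m h = F (D₁.xi n m h) (D₁.expTheta n m h) (D₁.expEta n m h)) := by
  refine ⟨fun n m h hξ ↦ D.tau_eq_tauExpansion hκ hξ, fun n m h hξ θ η A E hθ hη hA hE ↦ ?_,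
    D.tauExpansion, fun D₁ hL hk hk' hC n m h hξ ↦ ?_⟩
  · rw [D.tau_eq_tauExpansion hκ hξ, EllipticSolitonData.tauExpansion]
    refine congrArg (1 + ·) (Finset.sum_congr rfl fun r _ ↦ Finset.sum_congr rfl fun i _ ↦ ?_)
    have hi : Complex.exp (∑ a, θ (i a) + ∑ a, ∑ b ∈ Finset.Ioi a, A (i a) (i b)) =
        (∏ a, D.expTheta n m h (i a)) * ∏ a, ∏ b ∈ Finset.Ioi a, D.expA (i a) (i b) := by
      simp only [Complex.exp_add, Complex.exp_sum, hθ]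
      refine congrArg _ (Finset.prod_congr rfl fun a _ ↦ Finset.prod_congr rfl fun b hb ↦ ?_)
      exact hA _ _ (i.strictMono (Finset.mem_Ioi.mp hb))
    rw [hi]
    refine congrArg _ (Finset.sum_congr rfl fun j _ ↦ ?_)
    have hj : Complex.exp (∑ f, η (j f) + ∑ f, ∑ g ∈ Finset.Ioi f, E (j f) (j g)) =
        (∏ f, D.expEta n m h (j f)) * ∏ f, ∏ g ∈ Finset.Ioi f, D.expE (j f) (j g) := by
      simp only [Complex.exp_add, Complex.exp_sum, hη]
      refine congrArg _ (Finset.prod_congr rfl fun f _ ↦ Finset.prod_congr rfl fun g hg ↦ ?_)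
      exact hE _ _ (j.strictMono (Finset.mem_Ioi.mp hg))
    rw [hj]
  · rw [D₁.tau_eq_tauExpansion (by rw [hL, hk, hk']; exact hκ) hξ,
      D.tauExpansion_congr hL hk hk' hC]
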